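/- A geometric $(n_k)$ configuration is a nonempty set of $n$ points together with a set of $n$ straight lines in the Euclidean plane such that each of the points lies on exactly $k$ of the lines and each of the lines passes through exactly $k$ of the points. Let $N_k$ denote the smallest natural number such that for every integer $n \ge N_k$ there exists a geometric $(n_k)$ configuration, if such a number exists. **Lemma.** Let $k \ge 3$ be an integer and suppose that $N_{k-1}$ exists. Then $N_k$ exists, and for every integer $\bar N_{k-1} \ge N_{k-1}$ the number $$(k^2-1)\max(\bar N_{k-1},\, k^2-2)$$ is an upper bound for $N_k$. Moreover, a better upper bound for $N_{k-1}$ gives an upper bound for $N_k$ that is at least as good: if $N_{k-1} \le \bar N_{k-1} < \tilde N_{k-1}$ are integers, then $$(k^2-1)\max(\bar N_{k-1},\, k^2-2) \le (k^2-1)\max(\tilde N_{k-1},\, k^2-2),$$ and this inequality is strict if and only if $\tilde N_{k-1} > k^2-2$. -/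

import Mathlib

/-- The Euclidean plane. -/
abbrev Plane : Type := EuclideanSpace ℝ (Fin 2)

/-- A straight line of the Euclidean plane: a nonempty affine subspace of dimension one. -/
def IsStraightLine (l : AffineSubspace ℝ Plane) : Prop :=
  (l : Set Plane).Nonempty ∧ Module.finrank ℝ l.direction = 1

/-- A geometric `(n_k)` configuration: a (nonempty) set of `n` points and a set of `n` straight
lines in the Euclidean plane such that every one of the points lies on exactly `k` of the lines
and every one of the lines passes through exactly `k` of the points. -/
structure IsGeometricConfiguration (n k : ℕ) (P : Finset Plane)
    (L : Finset (AffineSubspace ℝ Plane)) : Prop where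
  nonempty : P.Nonempty
  isStraightLine : ∀ l ∈ L, IsStraightLine l
  card_points : P.card = n
  card_lines : L.card = n
  lines_through_point : ∀ p ∈ P, {l : AffineSubspace ℝ Plane | l ∈ L ∧ p ∈ l}.ncard = k
  points_on_line : ∀ l ∈ L, {p : Plane | p ∈ P ∧ p ∈ l}.ncard = k

/-- `n` is `k`-realizable if there exists a geometric `(n_k)` configuration. -/
def IsRealizable (k n : ℕ) : Prop :=
  ∃ (P : Finset Plane) (L : Finset (AffineSubspace ℝ Plane)), IsGeometricConfiguration n k P L

/-- `IsConfigurationNumber k N` says that the number `N_k` exists and equals `N`: it is the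
smallest natural number such that every `n ≥ N` is `k`-realizable. -/
def IsConfigurationNumber (k N : ℕ) : Prop :=
  IsLeast {M : ℕ | ∀ n : ℕ, M ≤ n → IsRealizable k n} N

/-- The bound `(k² - 1) · max(a, k² - 2)`; the subtractions do not truncate for `2 ≤ k`. -/
def configurationBound (k a : ℕ) : ℕ := (k ^ 2 - 1) * max a (k ^ 2 - 2)

/-! Put j = k - 1. Two constructions turn an (m_j) configuration into (n_k) configurations for a
whole interval of n. Affine replication (`CoordConfig.replicate`): stretch the configuration
horizontally by j + 1 factors. The images of a line meet on the y-axis, and the images of a point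
share a horizontal line. Adding these axis points and horizontal lines raises every incidence number
by one and gives a configuration with (j + 2)m points, m of whose lines are parallel. Affine switch
(`CoordConfig.affineSwitch`): take j affine images of that configuration and delete r ≤ m of the
parallel lines from each. Lines joining corresponding points of a deleted line concur in one new
point, so adding joins and concurrency points repairs all incidences. The result has j(j + 2)m + r
points. Since j(j + 2) = k² - 1, letting r run over 0, ..., m covers everything from (k² - 1)m on as
soon as m ≥ k² - 2, as consecutive intervals then leave no gap. Unwanted coincidences are avoided by
generic parameters: each one excludes only finitely many real values, hence the filter
`Filter.cofinite`. Everything is done with non-vertical lines in slope-intercept coordinates. -/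

/-- Incidence of the point `p = (x, y)` with the non-vertical line `l = (m, b)`, i.e. `y = m x + b`. -/
def Inc (p l : ℝ × ℝ) : Prop := p.2 = l.1 * p.1 + l.2

/-- A configuration all of whose lines are non-vertical, in coordinates. -/
structure CoordConfig (n k : ℕ) (P L : Finset (ℝ × ℝ)) : Prop where
  card_points : P.card = n
  card_lines : L.card = n
  lines_through : ∀ p ∈ P, {l | l ∈ L ∧ Inc p l}.ncard = k
  points_on : ∀ l ∈ L, {p | p ∈ P ∧ Inc p l}.ncard = k

/-! ### Avoiding finitely many bad parameters -/

theorem eventually_cofinite_linear {a b : ℝ} (ha : a ≠ 0 ∨ b ≠ 0) :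
    ∀ᶠ t : ℝ in Filter.cofinite, a * t ≠ b := by
  rw [Filter.eventually_cofinite]
  apply (Set.finite_singleton (b / a)).subset
  intro t ht
  simp only [Set.mem_ofPred_eq, not_not] at ht
  rcases eq_or_ne a 0 with h | h
  · subst h
    simp at ht ha
    exact absurd ht.symm ha
  · simp only [Set.mem_singleton_iff]
    field_simp
    linarith

theorem eventually_cofinite_quadratic (a b : ℝ) :
    ∀ᶠ t : ℝ in Filter.cofinite, t * t ≠ a * t + b := by
  rw [Filter.eventually_cofinite]
  by_cases h : ∃ r : ℝ, r * r = a * r + b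
  · obtain ⟨r, hr⟩ := h
    -- By Vieta, the roots of t² - at - b sum to a.
    apply (Set.toFinite {r, a - r}).subset
    intro t ht
    simp only [Set.mem_ofPred_eq, not_not] at ht
    have : (t - r) * (t - (a - r)) = 0 := by linear_combination ht - hr
    rcases mul_eq_zero.1 this with h | h
    · left; linarith
    · right; simp only [Set.mem_singleton_iff]; linarith
  · push Not at h
    convert Set.finite_empty
    ext t
    simp [h t]

/-- Greedy choice of finitely many pairwise independent parameters. -/
theorem exists_finset_pairwise {G : ℝ → Prop} {R : ℝ → ℝ → Prop}
    (hG : ∀ᶠ t in Filter.cofinite, G t)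
    (hR : ∀ u, G u → ∀ᶠ t in Filter.cofinite, R t u ∧ R u t) (n : ℕ) :
    ∃ T : Finset ℝ, T.card = n ∧ (∀ t ∈ T, G t) ∧ ∀ t ∈ T, ∀ u ∈ T, t ≠ u → R t u := by
  classical
  induction n with
  | zero => exact ⟨∅, by simp⟩
  | succ n ih =>
    obtain ⟨T, hT, hTG, hTR⟩ := ih
    -- `R` need not be symmetric, so the new parameter is tested in both slots.
    have h1 : ∀ᶠ t in Filter.cofinite, ∀ u ∈ T, R t u ∧ R u t :=
      (Filter.eventually_all_finset T).2 fun u hu => hR u (hTG u hu)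
    have h2 : ∀ᶠ t in Filter.cofinite, t ∉ T := T.finite_toSet.eventually_cofinite_notMem
    obtain ⟨t, ⟨ht1, ht2⟩, ht3⟩ := ((hG.and h1).and h2).exists
    refine ⟨insert t T, by simp [ht3, hT], ?_, ?_⟩
    · intro u hu
      rcases Finset.mem_insert.1 hu with rfl | hu
      exacts [ht1, hTG u hu]
    · intro u hu v hv huv
      rcases Finset.mem_insert.1 hu with rfl | hu' <;> rcases Finset.mem_insert.1 hv with rfl | hv'
      · exact absurd rfl huv
      · exact (ht2 v hv').1
      · exact (ht2 u hu').2
      · exact hTR u hu' v hv' huv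

/-! ### Affine changes of coordinates and general position -/

/-- Injective maps preserving incidence transport configurations. -/
theorem CoordConfig.image [DecidableEq (ℝ × ℝ)] {n k : ℕ} {P L : Finset (ℝ × ℝ)}
    (h : CoordConfig n k P L) {f g : ℝ × ℝ → ℝ × ℝ} (hf : f.Injective) (hg : g.Injective)
    (hfg : ∀ p l, Inc (f p) (g l) ↔ Inc p l) : CoordConfig n k (P.image f) (L.image g) := by
  refine ⟨by rw [Finset.card_image_of_injective _ hf, h.card_points],
    by rw [Finset.card_image_of_injective _ hg, h.card_lines], ?_, ?_⟩
  · intro p hp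
    obtain ⟨p, hp', rfl⟩ := Finset.mem_image.1 hp
    rw [← h.lines_through p hp', ← Set.ncard_image_of_injective {l | l ∈ L ∧ Inc p l} hg]
    congr 1
    ext y
    simp only [Finset.mem_image, Set.mem_ofPred_eq, Set.mem_image]
    constructor
    · rintro ⟨⟨l, hl, rfl⟩, hi⟩
      exact ⟨l, ⟨hl, (hfg _ _).1 hi⟩, rfl⟩
    · rintro ⟨l, ⟨hl, hi⟩, rfl⟩
      exact ⟨⟨l, hl, rfl⟩, (hfg _ _).2 hi⟩
  · intro l hl
    obtain ⟨l, hl', rfl⟩ := Finset.mem_image.1 hl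
    rw [← h.points_on l hl', ← Set.ncard_image_of_injective {p | p ∈ P ∧ Inc p l} hf]
    congr 1
    ext y
    simp only [Finset.mem_image, Set.mem_ofPred_eq, Set.mem_image]
    constructor
    · rintro ⟨⟨p, hp, rfl⟩, hi⟩
      exact ⟨p, ⟨hp, (hfg _ _).1 hi⟩, rfl⟩
    · rintro ⟨p, ⟨hp, hi⟩, rfl⟩
      exact ⟨⟨p, hp, rfl⟩, (hfg _ _).2 hi⟩

/-- Vertical shear `(x, y) ↦ (x, y + α x)`. -/
theorem CoordConfig.shear [DecidableEq (ℝ × ℝ)] {n k : ℕ} {P L : Finset (ℝ × ℝ)}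
    (h : CoordConfig n k P L) (α : ℝ) :
    CoordConfig n k (P.image fun p => (p.1, p.2 + α * p.1)) (L.image fun l => (l.1 + α, l.2)) := by
  apply h.image
  · rintro ⟨a, b⟩ ⟨c, d⟩ h
    simp only [Prod.mk.injEq] at h ⊢
    obtain ⟨rfl, h⟩ := h
    exact ⟨rfl, by linarith⟩
  · rintro ⟨a, b⟩ ⟨c, d⟩ h
    simpa using h
  · intro p l
    simp only [Inc]
    constructor <;> intro h <;> linarith

/-- Horizontal translation `(x, y) ↦ (x + γ, y)`. -/
theorem CoordConfig.translate [DecidableEq (ℝ × ℝ)] {n k : ℕ} {P L : Finset (ℝ × ℝ)}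
    (h : CoordConfig n k P L) (γ : ℝ) :
    CoordConfig n k (P.image fun p => (p.1 + γ, p.2))
      (L.image fun l => (l.1, l.2 - l.1 * γ)) := by
  apply h.image
  · rintro ⟨a, b⟩ ⟨c, d⟩ h
    simpa using h
  · rintro ⟨a, b⟩ ⟨c, d⟩ h
    simp only [Prod.mk.injEq] at h ⊢
    obtain ⟨rfl, h⟩ := h
    exact ⟨rfl, by linarith⟩
  · intro p l
    simp only [Inc]
    constructor <;> intro h <;> linarith

/-- A configuration in general position with respect to the coordinate axes. -/
structure IsGeneric (P L : Finset (ℝ × ℝ)) : Prop where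
  fst_ne : ∀ p ∈ P, p.1 ≠ 0
  slope_ne : ∀ l ∈ L, l.1 ≠ 0
  snd_inj : ∀ p ∈ P, ∀ q ∈ P, p.2 = q.2 → p = q
  intercept_inj : ∀ l ∈ L, ∀ m ∈ L, l.2 = m.2 → l = m
  snd_ne : ∀ p ∈ P, ∀ l ∈ L, p.2 ≠ l.2

theorem CoordConfig.exists_generic {n k : ℕ} {P L : Finset (ℝ × ℝ)} (h : CoordConfig n k P L) :
    ∃ P' L', CoordConfig n k P' L' ∧ IsGeneric P' L' := by
  classical
  -- The shear comes before the translation: a horizontal translation changes neither slopes nor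
  -- y-coordinates, so what the shear achieves survives, and nonzero slopes are what lets the
  -- translation move intercepts off the y-coordinates (`e3`).
  obtain ⟨P₁, L₁, h₁, hs, hy⟩ : ∃ P₁ L₁, CoordConfig n k P₁ L₁ ∧ (∀ l ∈ L₁, l.1 ≠ 0) ∧
      ∀ p ∈ P₁, ∀ q ∈ P₁, p.2 = q.2 → p = q := by
    have e1 : ∀ᶠ α : ℝ in Filter.cofinite, ∀ l ∈ L, 1 * α ≠ -l.1 :=
      (Filter.eventually_all_finset L).2 fun l _ => eventually_cofinite_linear (by simp)
    have e2 : ∀ᶠ α : ℝ in Filter.cofinite, ∀ p ∈ P, ∀ q ∈ P, p ≠ q →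
        (p.1 - q.1) * α ≠ q.2 - p.2 := by
      refine (Filter.eventually_all_finset P).2 fun p _ =>
        (Filter.eventually_all_finset P).2 fun q _ => ?_
      by_cases hpq : p = q
      · simp [hpq]
      · refine (eventually_cofinite_linear ?_).mono fun α hα _ => hα
        by_contra! hc
        exact hpq (Prod.ext (by linarith) (by linarith))
    obtain ⟨α, h1, h2⟩ := (e1.and e2).exists
    refine ⟨_, _, h.shear α, ?_, ?_⟩
    · intro l hl
      obtain ⟨l, hl', rfl⟩ := Finset.mem_image.1 hl
      intro h0
      exact h1 l hl' (by simp at h0; linarith)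
    · intro p hp q hq hpq
      obtain ⟨p, hp', rfl⟩ := Finset.mem_image.1 hp
      obtain ⟨q, hq', rfl⟩ := Finset.mem_image.1 hq
      by_cases hpq' : p = q
      · rw [hpq']
      · exact absurd (by simp at hpq; linarith) (h2 p hp' q hq' hpq')
  have e1 : ∀ᶠ γ : ℝ in Filter.cofinite, ∀ p ∈ P₁, 1 * γ ≠ -p.1 :=
    (Filter.eventually_all_finset P₁).2 fun p _ => eventually_cofinite_linear (by simp)
  have e2 : ∀ᶠ γ : ℝ in Filter.cofinite, ∀ l ∈ L₁, ∀ m ∈ L₁, l ≠ m →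
      (l.1 - m.1) * γ ≠ l.2 - m.2 := by
    refine (Filter.eventually_all_finset L₁).2 fun l _ =>
      (Filter.eventually_all_finset L₁).2 fun m _ => ?_
    by_cases hlm : l = m
    · simp [hlm]
    · refine (eventually_cofinite_linear ?_).mono fun α hα _ => hα
      by_contra! hc
      exact hlm (Prod.ext (by linarith) (by linarith))
  have e3 : ∀ᶠ γ : ℝ in Filter.cofinite, ∀ l ∈ L₁, ∀ p ∈ P₁, l.1 * γ ≠ l.2 - p.2 :=
    (Filter.eventually_all_finset L₁).2 fun l hl => (Filter.eventually_all_finset P₁).2 fun p _ =>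
      eventually_cofinite_linear (Or.inl (hs l hl))
  obtain ⟨γ, ⟨h1, h2⟩, h3⟩ := ((e1.and e2).and e3).exists
  refine ⟨_, _, h₁.translate γ, ⟨?_, ?_, ?_, ?_, ?_⟩⟩
  · intro p hp
    obtain ⟨p, hp', rfl⟩ := Finset.mem_image.1 hp
    intro h0
    exact h1 p hp' (by simp at h0; linarith)
  · intro l hl
    obtain ⟨l, hl', rfl⟩ := Finset.mem_image.1 hl
    exact hs l hl'
  · intro p hp q hq hpq
    obtain ⟨p, hp', rfl⟩ := Finset.mem_image.1 hp
    obtain ⟨q, hq', rfl⟩ := Finset.mem_image.1 hq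
    rw [hy p hp' q hq' hpq]
  · intro l hl m hm hlm
    obtain ⟨l, hl', rfl⟩ := Finset.mem_image.1 hl
    obtain ⟨m, hm', rfl⟩ := Finset.mem_image.1 hm
    by_cases hlm' : l = m
    · rw [hlm']
    · exact absurd (by simp at hlm; linarith) (h2 l hl' m hm' hlm')
  · intro p hp l hl hpl
    obtain ⟨p, hp', rfl⟩ := Finset.mem_image.1 hp
    obtain ⟨l, hl', rfl⟩ := Finset.mem_image.1 hl
    exact h3 l hl' p hp' (by simp at hpl; linarith)

/-! ### Affine replication -/

/-- Affine replication: the images of an `(m_k)` configuration under `k + 1` affinities with a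
common axis, together with the `m` points on the axis and the `m` lines joining corresponding
points. -/
theorem CoordConfig.replicate {m k : ℕ} {P L : Finset (ℝ × ℝ)} (h : CoordConfig m k P L) :
    ∃ P' L', CoordConfig ((k + 2) * m) (k + 1) P' L' ∧ ∃ H ⊆ L', H.card = m ∧ ∀ l ∈ H, l.1 = 0 := by
  classical
  obtain ⟨P, L, h, g⟩ := h.exists_generic
  -- `R t u` says that no point of the image with factor t lies on a line of the image with factor
  -- u.
  obtain ⟨T, hTc, hT0, hTR⟩ := exists_finset_pairwise (G := fun t => t ≠ 0)
    (R := fun t u => ∀ p ∈ P, ∀ l ∈ L, u * (p.2 - l.2) ≠ l.1 * t * p.1)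
    (by simp)
    (fun u hu => by
      refine Filter.Eventually.and ?_ ?_
      · refine (Filter.eventually_all_finset P).2 fun p hp =>
          (Filter.eventually_all_finset L).2 fun l hl => ?_
        refine (eventually_cofinite_linear (a := l.1 * p.1) (b := u * (p.2 - l.2)) (Or.inl
          (mul_ne_zero (g.slope_ne l hl) (g.fst_ne p hp)))).mono fun t ht ht' => ht ?_
        rw [ht']; ring
      · refine (Filter.eventually_all_finset P).2 fun p hp =>
          (Filter.eventually_all_finset L).2 fun l hl => ?_
        refine (eventually_cofinite_linear (a := p.2 - l.2) (b := l.1 * u * p.1) (Or.inl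
          (sub_ne_zero.2 (g.snd_ne p hp l hl)))).mono fun t ht ht' => ht ?_
        rw [← ht']; ring) (k + 1)
  -- `f` and `e` are the action of (x, y) ↦ (t x, y) on points and lines. `z` serves twice: on a
  -- line it gives its axis point, on a point the horizontal line through it.
  let f : ℝ × ℝ × ℝ → ℝ × ℝ := fun x => (x.1 * x.2.1, x.2.2)
  let e : ℝ × ℝ × ℝ → ℝ × ℝ := fun x => (x.2.1 / x.1, x.2.2)
  let z : ℝ × ℝ → ℝ × ℝ := fun x => (0, x.2)
  have hinc : ∀ t ∈ T, ∀ u ∈ T, ∀ p ∈ P, ∀ l ∈ L,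
      (Inc (f (t, p)) (e (u, l)) ↔ t = u ∧ Inc p l) := by
    intro t ht u hu p hp l hl
    have hu0 := hT0 u hu
    by_cases htu : t = u
    · subst htu
      simp only [Inc, f, e, true_and]
      rw [show l.1 / t * (t * p.1) = l.1 * p.1 by field_simp]
    · simp only [htu, false_and, iff_false, Inc, f, e]
      intro hi
      refine hTR t ht u hu htu p hp l hl ?_
      rw [hi]; field_simp; ring
  have hfz : ∀ t, ∀ p ∈ P, ∀ q ∈ P, (Inc (f (t, p)) (z q) ↔ p = q) := by
    intro t p hp q hq
    simp only [Inc, f, z, zero_mul, zero_add]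
    exact ⟨g.snd_inj p hp q hq, fun h => h ▸ rfl⟩
  have hze : ∀ t, ∀ l ∈ L, ∀ l' ∈ L, (Inc (z l) (e (t, l')) ↔ l = l') := by
    intro t l hl l' hl'
    simp only [Inc, e, z, mul_zero, zero_add]
    exact ⟨g.intercept_inj l hl l' hl', fun h => h ▸ rfl⟩
  have hzz : ∀ l ∈ L, ∀ p ∈ P, ¬ Inc (z l) (z p) := by
    intro l hl p hp
    simp only [Inc, z, mul_zero, zero_add]
    exact (g.snd_ne p hp l hl).symm
  have hf : Set.InjOn f (T ×ˢ P : Finset _) := by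
    rintro ⟨t, p⟩ hx ⟨u, q⟩ hy hxy
    simp only [Finset.coe_product, Set.mem_prod, Finset.mem_coe] at hx hy
    simp only [f, Prod.mk.injEq] at hxy
    obtain rfl := g.snd_inj p hx.2 q hy.2 hxy.2
    rw [mul_left_injective₀ (g.fst_ne p hx.2) hxy.1]
  have he : Set.InjOn e (T ×ˢ L : Finset _) := by
    rintro ⟨t, p⟩ hx ⟨u, q⟩ hy hxy
    simp only [Finset.coe_product, Set.mem_prod, Finset.mem_coe] at hx hy
    simp only [e, Prod.mk.injEq] at hxy
    obtain rfl := g.intercept_inj p hx.2 q hy.2 hxy.2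
    have := hxy.1
    rw [div_eq_div_iff (hT0 t hx.1) (hT0 u hy.1)] at this
    rw [mul_right_injective₀ (g.slope_ne p hx.2) this]
  have hzP : Set.InjOn z P := by
    intro p hp q hq hpq
    simp only [z, Prod.mk.injEq, true_and] at hpq
    exact g.snd_inj p hp q hq hpq
  have hzL : Set.InjOn z L := by
    intro p hp q hq hpq
    simp only [z, Prod.mk.injEq, true_and] at hpq
    exact g.intercept_inj p hp q hq hpq
  have hd1 : Disjoint ((T ×ˢ P).image f) (L.image z) := by
    rw [Finset.disjoint_left]
    intro x hx hx'
    obtain ⟨⟨t, p⟩, htx, rfl⟩ := Finset.mem_image.1 hx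
    obtain ⟨l, hl, hx'⟩ := Finset.mem_image.1 hx'
    rw [Finset.mem_product] at htx
    exact mul_ne_zero (hT0 t htx.1) (g.fst_ne p htx.2) (congrArg Prod.fst hx').symm
  have hd2 : Disjoint ((T ×ˢ L).image e) (P.image z) := by
    rw [Finset.disjoint_left]
    intro x hx hx'
    obtain ⟨⟨t, p⟩, htx, rfl⟩ := Finset.mem_image.1 hx
    obtain ⟨l, hl, hx'⟩ := Finset.mem_image.1 hx'
    rw [Finset.mem_product] at htx
    exact div_ne_zero (g.slope_ne p htx.2) (hT0 t htx.1) (congrArg Prod.fst hx').symm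
  refine ⟨(T ×ˢ P).image f ∪ L.image z, (T ×ˢ L).image e ∪ P.image z, ⟨?_, ?_, ?_, ?_⟩,
    P.image z, Finset.subset_union_right, ?_, ?_⟩
  · rw [Finset.card_union_of_disjoint hd1, Finset.card_image_of_injOn hf,
      Finset.card_image_of_injOn hzL, Finset.card_product, hTc, h.card_points, h.card_lines]
    ring
  · rw [Finset.card_union_of_disjoint hd2, Finset.card_image_of_injOn he,
      Finset.card_image_of_injOn hzP, Finset.card_product, hTc, h.card_points, h.card_lines]
    ring
  · intro x hx
    rcases Finset.mem_union.1 hx with hx | hx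
    · obtain ⟨⟨t, p⟩, htx, rfl⟩ := Finset.mem_image.1 hx
      obtain ⟨ht, hp⟩ : t ∈ T ∧ p ∈ P := Finset.mem_product.1 htx
      have hset : {l | l ∈ (T ×ˢ L).image e ∪ P.image z ∧ Inc (f (t, p)) l} =
          insert (z p) ((fun l => e (t, l)) '' {l | l ∈ L ∧ Inc p l}) := by
        ext y
        simp only [Finset.mem_union, Finset.mem_image, Finset.mem_product,
          Prod.exists (α := ℝ) (β := ℝ × ℝ), Set.mem_ofPred_eq, Set.mem_insert_iff, Set.mem_image]
        constructor
        · rintro ⟨⟨u, l, ⟨hu, hl⟩, rfl⟩ | ⟨q, hq, rfl⟩, hi⟩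
          · obtain ⟨rfl, hi'⟩ := (hinc t ht u hu p hp l hl).1 hi
            exact Or.inr ⟨l, ⟨hl, hi'⟩, rfl⟩
          · exact Or.inl (by rw [(hfz t p hp q hq).1 hi])
        · rintro (rfl | ⟨l, ⟨hl, hi⟩, rfl⟩)
          · exact ⟨Or.inr ⟨p, hp, rfl⟩, (hfz t p hp p hp).2 rfl⟩
          · exact ⟨Or.inl ⟨t, l, ⟨ht, hl⟩, rfl⟩, (hinc t ht t ht p hp l hl).2 ⟨rfl, hi⟩⟩
      have hfin : {l | l ∈ L ∧ Inc p l}.Finite := L.finite_toSet.subset fun l hl => hl.1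
      rw [hset, Set.ncard_insert_of_notMem _ (hfin.image _), Set.InjOn.ncard_image,
        h.lines_through p hp]
      · intro l hl l' hl' hll
        exact (Prod.mk.inj (he (by simpa using ⟨ht, hl.1⟩) (by simpa using ⟨ht, hl'.1⟩) hll)).2
      · rintro ⟨l, hl, hlz⟩
        exact Finset.disjoint_left.1 hd2 (Finset.mem_image_of_mem e
          (Finset.mk_mem_product ht hl.1)) ((show e (t, l) = z p from hlz) ▸ Finset.mem_image_of_mem z hp)
    · obtain ⟨l, hl, rfl⟩ := Finset.mem_image.1 hx
      have hset : {l' | l' ∈ (T ×ˢ L).image e ∪ P.image z ∧ Inc (z l) l'} =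
          (fun t => e (t, l)) '' T := by
        ext y
        simp only [Finset.mem_union, Finset.mem_image, Finset.mem_product,
          Prod.exists (α := ℝ) (β := ℝ × ℝ), Set.mem_ofPred_eq, Set.mem_image, Finset.mem_coe]
        constructor
        · rintro ⟨⟨u, l', ⟨hu, hl'⟩, rfl⟩ | ⟨q, hq, rfl⟩, hi⟩
          · obtain rfl := (hze u l hl l' hl').1 hi
            exact ⟨u, hu, rfl⟩
          · exact absurd hi (hzz l hl q hq)
        · rintro ⟨t, ht, rfl⟩
          exact ⟨Or.inl ⟨t, l, ⟨ht, hl⟩, rfl⟩, (hze t l hl l hl).2 rfl⟩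
      rw [hset, Set.InjOn.ncard_image, Set.ncard_coe_finset, hTc]
      intro t ht u hu htu
      exact (Prod.mk.inj (he (by simpa using ⟨ht, hl⟩) (by simpa using ⟨hu, hl⟩) htu)).1
  · intro x hx
    rcases Finset.mem_union.1 hx with hx | hx
    · obtain ⟨⟨t, l⟩, htx, rfl⟩ := Finset.mem_image.1 hx
      obtain ⟨ht, hl⟩ : t ∈ T ∧ l ∈ L := Finset.mem_product.1 htx
      have hset : {p | p ∈ (T ×ˢ P).image f ∪ L.image z ∧ Inc p (e (t, l))} =
          insert (z l) ((fun p => f (t, p)) '' {p | p ∈ P ∧ Inc p l}) := by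
        ext y
        simp only [Finset.mem_union, Finset.mem_image, Finset.mem_product,
          Prod.exists (α := ℝ) (β := ℝ × ℝ), Set.mem_ofPred_eq, Set.mem_insert_iff, Set.mem_image]
        constructor
        · rintro ⟨⟨u, p, ⟨hu, hp⟩, rfl⟩ | ⟨q, hq, rfl⟩, hi⟩
          · obtain ⟨rfl, hi'⟩ := (hinc u hu t ht p hp l hl).1 hi
            exact Or.inr ⟨p, ⟨hp, hi'⟩, rfl⟩
          · exact Or.inl (by rw [(hze t q hq l hl).1 hi])
        · rintro (rfl | ⟨p, ⟨hp, hi⟩, rfl⟩)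
          · exact ⟨Or.inr ⟨l, hl, rfl⟩, (hze t l hl l hl).2 rfl⟩
          · exact ⟨Or.inl ⟨t, p, ⟨ht, hp⟩, rfl⟩, (hinc t ht t ht p hp l hl).2 ⟨rfl, hi⟩⟩
      have hfin : {p | p ∈ P ∧ Inc p l}.Finite := P.finite_toSet.subset fun p hp => hp.1
      rw [hset, Set.ncard_insert_of_notMem _ (hfin.image _), Set.InjOn.ncard_image,
        h.points_on l hl]
      · intro p hp p' hp' hpp
        exact (Prod.mk.inj (hf (by simpa using ⟨ht, hp.1⟩) (by simpa using ⟨ht, hp'.1⟩) hpp)).2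
      · rintro ⟨p, hp, hpz⟩
        exact Finset.disjoint_left.1 hd1 (Finset.mem_image_of_mem f
          (Finset.mk_mem_product ht hp.1)) ((show f (t, p) = z l from hpz) ▸ Finset.mem_image_of_mem z hl)
    · obtain ⟨p, hp, rfl⟩ := Finset.mem_image.1 hx
      have hset : {p' | p' ∈ (T ×ˢ P).image f ∪ L.image z ∧ Inc p' (z p)} =
          (fun t => f (t, p)) '' T := by
        ext y
        simp only [Finset.mem_union, Finset.mem_image, Finset.mem_product,
          Prod.exists (α := ℝ) (β := ℝ × ℝ), Set.mem_ofPred_eq, Set.mem_image, Finset.mem_coe]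
        constructor
        · rintro ⟨⟨u, p', ⟨hu, hp'⟩, rfl⟩ | ⟨q, hq, rfl⟩, hi⟩
          · obtain rfl := (hfz u p' hp' p hp).1 hi
            exact ⟨u, hu, rfl⟩
          · exact absurd hi (hzz q hq p hp)
        · rintro ⟨t, ht, rfl⟩
          exact ⟨Or.inl ⟨t, p, ⟨ht, hp⟩, rfl⟩, (hfz t p hp p hp).2 rfl⟩
      rw [hset, Set.InjOn.ncard_image, Set.ncard_coe_finset, hTc]
      intro t ht u hu htu
      exact (Prod.mk.inj (hf (by simpa using ⟨ht, hp⟩) (by simpa using ⟨hu, hp⟩) htu)).1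
  · rw [Finset.card_image_of_injOn hzP, h.card_points]
  · intro l hl
    obtain ⟨p, -, rfl⟩ := Finset.mem_image.1 hl
    rfl

/-! ### Affine switch -/

/-- The affine switch: among `k` affine images of an `(n_{k+1})` configuration, `r` parallel lines
are removed from each image and replaced by `r` new points and `r (k + 1)` new lines joining
corresponding points. -/
theorem CoordConfig.affineSwitch {n k r : ℕ} {P L H : Finset (ℝ × ℝ)}
    (h : CoordConfig n (k + 1) P L) (hHL : H ⊆ L) (hr : r ≤ H.card) (hH0 : ∀ l ∈ H, l.1 = 0) :
    ∃ P' L', CoordConfig (k * n + r) (k + 1) P' L' := by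
  classical
  obtain ⟨P, L, R, h, hRL, hRr, hR0, hP0⟩ : ∃ P L R : Finset (ℝ × ℝ), CoordConfig n (k + 1) P L ∧
      R ⊆ L ∧ R.card = r ∧ (∀ l ∈ R, l.1 = 0) ∧ ∀ p ∈ P, p.1 ≠ 0 := by
    obtain ⟨R, hRH, hRr⟩ := Finset.exists_subset_card_eq hr
    have e1 : ∀ᶠ γ : ℝ in Filter.cofinite, ∀ p ∈ P, 1 * γ ≠ -p.1 :=
      (Filter.eventually_all_finset P).2 fun p _ => eventually_cofinite_linear (by simp)
    obtain ⟨γ, hγ⟩ := e1.exists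
    -- A horizontal translation fixes every horizontal line, so `R` stays the same.
    refine ⟨_, _, R, h.translate γ, ?_, hRr, fun l hl => hH0 l (hRH hl), ?_⟩
    · intro l hl
      refine Finset.mem_image.2 ⟨l, hHL (hRH hl), ?_⟩
      ext <;> simp [hH0 l (hRH hl)]
    · intro p hp
      obtain ⟨p, hp', rfl⟩ := Finset.mem_image.1 hp
      intro h0
      exact hγ p hp' (by simp at h0; linarith)
  -- Clauses of `G`, after t ≠ 0: t ≠ l.1 * p.1 keeps the first clause of `R` a nondegenerate linear
  -- condition; t ≠ p.2 - l.2 separates joins from image lines; the next keeps new points off image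
  -- lines; the last keeps an image of p off the join of any q ≠ p. Clauses of `R`: no incidence
  -- between different images, then no common points, then no common lines.
  obtain ⟨T, hTc, hTG, hTR⟩ := exists_finset_pairwise
    (G := fun t => t ≠ 0 ∧ (∀ p ∈ P, ∀ l ∈ L, t ≠ l.1 * p.1 ∧ t ≠ p.2 - l.2) ∧
      (∀ l ∈ L, ∀ m ∈ L, t ≠ l.2 - m.2) ∧
      ∀ p ∈ P, ∀ q ∈ P, p ≠ q → (p.1 - q.1) * t ≠ q.1 * (p.2 - q.2))
    (R := fun t u => (∀ p ∈ P, ∀ l ∈ L, u * (p.2 - l.2 + t - u) ≠ l.1 * t * p.1) ∧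
      (∀ p ∈ P, ∀ q ∈ P, t * p.1 ≠ u * q.1) ∧ ∀ l ∈ L, ∀ m ∈ L, l.2 + t ≠ m.2 + u)
    (by
      have hne : ∀ a : ℝ, ∀ᶠ t : ℝ in Filter.cofinite, t ≠ a := fun a => by simp
      refine (hne 0).and (Filter.Eventually.and ?_ (Filter.Eventually.and ?_ ?_))
      · exact (Filter.eventually_all_finset P).2 fun p hp =>
          (Filter.eventually_all_finset L).2 fun l hl => (hne _).and (hne _)
      · exact (Filter.eventually_all_finset L).2 fun p hp =>
          (Filter.eventually_all_finset L).2 fun l hl => hne _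
      · refine (Filter.eventually_all_finset P).2 fun p hp =>
          (Filter.eventually_all_finset P).2 fun q hq => ?_
        by_cases hpq : p = q
        · simp [hpq]
        · refine (eventually_cofinite_linear ?_).mono fun t ht _ => ht
          by_contra! hc
          refine hpq (Prod.ext (by linarith) ?_)
          have := (mul_eq_zero.1 hc.2).resolve_left (hP0 q hq)
          linarith)
    (fun u hu => by
      refine Filter.Eventually.and (Filter.Eventually.and ?_ (Filter.Eventually.and ?_ ?_))
        (Filter.Eventually.and ?_ (Filter.Eventually.and ?_ ?_))
      · refine (Filter.eventually_all_finset P).2 fun p hp =>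
          (Filter.eventually_all_finset L).2 fun l hl => ?_
        refine (eventually_cofinite_linear (a := u - l.1 * p.1) (b := u * (l.2 - p.2 + u)) (Or.inl
          (sub_ne_zero.2 (hu.2.1 p hp l hl).1))).mono fun t ht ht' => ht ?_
        linarith
      · refine (Filter.eventually_all_finset P).2 fun p hp =>
          (Filter.eventually_all_finset P).2 fun q hq => ?_
        refine (eventually_cofinite_linear (a := p.1) (b := u * q.1) (Or.inl
          (hP0 p hp))).mono fun t ht ht' => ht ?_
        linarith
      · refine (Filter.eventually_all_finset L).2 fun l hl =>
          (Filter.eventually_all_finset L).2 fun m hm => ?_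
        refine (eventually_cofinite_linear (a := 1) (b := m.2 + u - l.2) (Or.inl
          one_ne_zero)).mono fun t ht ht' => ht ?_
        linarith
      · refine (Filter.eventually_all_finset P).2 fun p hp =>
          (Filter.eventually_all_finset L).2 fun l hl => ?_
        -- In this slot the parameter gives both the stretch and the shift of the line, hence a
        -- quadratic condition.
        refine (eventually_cofinite_quadratic (p.2 - l.2 + u) (-(l.1 * u * p.1))).mono
          fun t ht ht' => ht ?_
        linarith
      · refine (Filter.eventually_all_finset P).2 fun p hp =>
          (Filter.eventually_all_finset P).2 fun q hq => ?_
        refine (eventually_cofinite_linear (a := q.1) (b := u * p.1) (Or.inl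
          (hP0 q hq))).mono fun t ht ht' => ht ?_
        linarith
      · refine (Filter.eventually_all_finset L).2 fun l hl =>
          (Filter.eventually_all_finset L).2 fun m hm => ?_
        refine (eventually_cofinite_linear (a := 1) (b := l.2 + u - m.2) (Or.inl
          one_ne_zero)).mono fun t ht ht' => ht ?_
        linarith) k
  -- The maps (x, y) ↦ (t x, y + t - 1) move each point p along the line `w p` as t varies. At t = 0
  -- they collapse the plane onto the y-axis, sending a horizontal line l to the single point `z l`,
  -- where the joins of its points therefore concur.
  let f : ℝ × ℝ × ℝ → ℝ × ℝ := fun x => (x.1 * x.2.1, x.2.2 + x.1 - 1)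
  let e : ℝ × ℝ × ℝ → ℝ × ℝ := fun x => (x.2.1 / x.1, x.2.2 + x.1 - 1)
  let z : ℝ × ℝ → ℝ × ℝ := fun l => (0, l.2 - 1)
  let w : ℝ × ℝ → ℝ × ℝ := fun p => (1 / p.1, p.2 - 1)
  let Q : Finset (ℝ × ℝ) := P.filter fun p => ∃ l ∈ R, Inc p l
  have hRinc : ∀ p, ∀ l ∈ R, (Inc p l ↔ p.2 = l.2) := by
    intro p l hl
    simp [Inc, hR0 l hl]
  have hRinj : ∀ l ∈ R, ∀ m ∈ R, l.2 = m.2 → l = m := fun l hl m hm hlm =>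
    Prod.ext ((hR0 l hl).trans (hR0 m hm).symm) hlm
  have hinc : ∀ t ∈ T, ∀ u ∈ T, ∀ p ∈ P, ∀ l ∈ L,
      (Inc (f (t, p)) (e (u, l)) ↔ t = u ∧ Inc p l) := by
    intro t ht u hu p hp l hl
    have hu0 := (hTG u hu).1
    by_cases htu : t = u
    · subst htu
      simp only [Inc, f, e, true_and]
      rw [show l.1 / t * (t * p.1) = l.1 * p.1 by field_simp]
      constructor <;> intro h <;> linarith
    · simp only [htu, false_and, iff_false, Inc, f, e]
      intro hi
      refine (hTR t ht u hu htu).1 p hp l hl ?_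
      rw [show p.2 - l.2 + t - u = l.1 / u * (t * p.1) by linarith]; field_simp
  have hfw : ∀ t ∈ T, ∀ p ∈ P, ∀ q ∈ P, (Inc (f (t, p)) (w q) ↔ p = q) := by
    intro t ht p hp q hq
    have hq0 := hP0 q hq
    simp only [Inc, f, w]
    constructor
    · intro hi
      by_contra hpq
      refine (hTG t ht).2.2.2 p hp q hq hpq ?_
      field_simp at hi
      linarith
    · rintro rfl
      field_simp
      ring
  have hze : ∀ t ∈ T, ∀ l ∈ R, ∀ m ∈ L, ¬ Inc (z l) (e (t, m)) := by
    intro t ht l hl m hm hi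
    simp only [Inc, e, z, mul_zero, zero_add] at hi
    exact (hTG t ht).2.2.1 l (hRL hl) m hm (by linarith)
  have hzw : ∀ l ∈ R, ∀ p, (Inc (z l) (w p) ↔ Inc p l) := by
    intro l hl p
    rw [hRinc p l hl]
    simp only [Inc, w, z, mul_zero, zero_add]
    constructor <;> intro h <;> linarith
  have hf : Set.InjOn f (T ×ˢ P : Finset _) := by
    rintro ⟨t, p⟩ hx ⟨u, q⟩ hy hxy
    simp only [Finset.coe_product, Set.mem_prod, Finset.mem_coe] at hx hy
    simp only [f, Prod.mk.injEq] at hxy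
    by_cases htu : t = u
    · subst htu
      rw [show p = q from Prod.ext (mul_right_injective₀ (hTG t hx.1).1 hxy.1) (by linarith)]
    · exact absurd hxy.1 ((hTR t hx.1 u hy.1 htu).2.1 p hx.2 q hy.2)
  have he : Set.InjOn e (T ×ˢ (L \ R) : Finset _) := by
    rintro ⟨t, p⟩ hx ⟨u, q⟩ hy hxy
    simp only [Finset.mem_coe, Finset.mem_product, Finset.mem_sdiff] at hx hy
    simp only [e, Prod.mk.injEq] at hxy
    by_cases htu : t = u
    · subst htu
      rw [show p = q from Prod.ext (by
        have := hxy.1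
        rwa [div_left_inj' (hTG t hx.1).1] at this) (by linarith)]
    · exact absurd (by linarith) ((hTR t hx.1 u hy.1 htu).2.2 p hx.2.1 q hy.2.1)
  have hz : Set.InjOn z R := by
    intro l hl m hm hlm
    simp only [z, Prod.mk.injEq, true_and] at hlm
    exact hRinj l hl m hm (by linarith)
  have hw : w.Injective := by
    intro p q hpq
    simp only [w, Prod.mk.injEq, one_div, inv_inj] at hpq
    exact Prod.ext hpq.1 (by linarith)
  have hd1 : Disjoint ((T ×ˢ P).image f) (R.image z) := by
    rw [Finset.disjoint_left]
    intro x hx hx'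
    obtain ⟨⟨t, p⟩, htx, rfl⟩ := Finset.mem_image.1 hx
    obtain ⟨l, hl, hx'⟩ := Finset.mem_image.1 hx'
    rw [Finset.mem_product] at htx
    exact mul_ne_zero (hTG t htx.1).1 (hP0 p htx.2) (congrArg Prod.fst hx').symm
  have hd2 : Disjoint ((T ×ˢ (L \ R)).image e) (Q.image w) := by
    rw [Finset.disjoint_left]
    intro x hx hx'
    obtain ⟨⟨t, l⟩, htx, rfl⟩ := Finset.mem_image.1 hx
    obtain ⟨p, hp, hx'⟩ := Finset.mem_image.1 hx'
    rw [Finset.mem_product, Finset.mem_sdiff] at htx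
    have := congrArg Prod.snd hx'
    simp only [w, e] at this
    exact ((hTG t htx.1).2.1 p (Finset.mem_filter.1 hp).1 l htx.2.1).2 (by linarith)
  -- The lines of `R` are parallel, so their point sets are disjoint.
  have hQ : Q.card = r * (k + 1) := by
    have hQe : Q = R.biUnion fun l => P.filter fun p => Inc p l := by
      ext p
      simp only [Q, Finset.mem_filter, Finset.mem_biUnion]
      tauto
    rw [hQe, Finset.card_biUnion, Finset.sum_const_nat (m := k + 1), hRr]
    · intro l hl
      rw [← h.points_on l (hRL hl), ← Set.ncard_coe_finset]
      congr 1
      ext p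
      simp
    · intro l hl m hm hlm
      simp only [Function.onFun, Finset.disjoint_left, Finset.mem_filter]
      rintro p ⟨-, hp⟩ ⟨-, hp'⟩
      rw [hRinc p l hl] at hp
      rw [hRinc p m hm] at hp'
      exact hlm (hRinj l hl m hm (hp.symm.trans hp'))
  refine ⟨(T ×ˢ P).image f ∪ R.image z, (T ×ˢ (L \ R)).image e ∪ Q.image w, ?_, ?_, ?_, ?_⟩
  · rw [Finset.card_union_of_disjoint hd1, Finset.card_image_of_injOn hf,
      Finset.card_image_of_injOn hz, Finset.card_product, hTc, h.card_points, hRr]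
  · rw [Finset.card_union_of_disjoint hd2, Finset.card_image_of_injOn he,
      Finset.card_image_of_injective _ hw, Finset.card_product, hTc, hQ,
      Finset.card_sdiff_of_subset hRL, h.card_lines, hRr]
    -- The line count is k(n - r) + r(k + 1) = kn + r.
    obtain ⟨d, rfl⟩ : ∃ d, n = r + d :=
      Nat.exists_eq_add_of_le (hRr ▸ h.card_lines ▸ Finset.card_le_card hRL)
    rw [Nat.add_sub_cancel_left]
    ring
  · intro x hx
    rcases Finset.mem_union.1 hx with hx | hx
    · obtain ⟨⟨t, p⟩, htx, rfl⟩ := Finset.mem_image.1 hx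
      obtain ⟨ht, hp⟩ : t ∈ T ∧ p ∈ P := Finset.mem_product.1 htx
      have hfin : {l | l ∈ L ∧ Inc p l}.Finite := L.finite_toSet.subset fun l hl => hl.1
      have hinj : ∀ S : Set (ℝ × ℝ), (∀ l ∈ S, l ∈ L \ R) → Set.InjOn (fun l => e (t, l)) S :=
        fun S hS l hl l' hl' hll => (Prod.mk.inj (he
          (Finset.mk_mem_product ht (hS l hl)) (Finset.mk_mem_product ht (hS l' hl')) hll)).2
      by_cases hpQ : p ∈ Q
      · obtain ⟨-, m, hm, hpm⟩ := Finset.mem_filter.1 hpQ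
        -- Through p passes exactly one line m of `R`; its image is traded for the join `w p`.
        have hset : {l | l ∈ (T ×ˢ (L \ R)).image e ∪ Q.image w ∧ Inc (f (t, p)) l} =
            insert (w p) ((fun l => e (t, l)) '' ({l | l ∈ L ∧ Inc p l} \ {m})) := by
          ext y
          simp only [Finset.mem_union, Finset.mem_image, Finset.mem_product,
            Prod.exists (α := ℝ) (β := ℝ × ℝ), Set.mem_ofPred_eq, Set.mem_insert_iff,
            Set.mem_image, Finset.mem_sdiff, Set.mem_sdiff, Set.mem_singleton_iff]
          constructor
          · rintro ⟨⟨u, l, ⟨hu, hl⟩, rfl⟩ | ⟨q, hq, rfl⟩, hi⟩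
            · obtain ⟨rfl, hi'⟩ := (hinc t ht u hu p hp l hl.1).1 hi
              exact Or.inr ⟨l, ⟨⟨hl.1, hi'⟩, fun hlm => hl.2 (hlm ▸ hm)⟩, rfl⟩
            · exact Or.inl (by rw [(hfw t ht p hp q (Finset.mem_filter.1 hq).1).1 hi])
          · rintro (rfl | ⟨l, ⟨⟨hl, hi⟩, hlm⟩, rfl⟩)
            · exact ⟨Or.inr ⟨p, hpQ, rfl⟩, (hfw t ht p hp p hp).2 rfl⟩
            · refine ⟨Or.inl ⟨t, l, ⟨ht, hl, fun hlR => hlm (hRinj l hlR m hm ?_)⟩, rfl⟩,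
                (hinc t ht t ht p hp l hl).2 ⟨rfl, hi⟩⟩
              rw [← (hRinc p l hlR).1 hi, ← (hRinc p m hm).1 hpm]
        have hmem : ∀ l ∈ {l | l ∈ L ∧ Inc p l} \ {m}, l ∈ L \ R := by
          rintro l ⟨⟨hl, hi⟩, hlm⟩
          refine Finset.mem_sdiff.2 ⟨hl, fun hlR => hlm (hRinj l hlR m hm ?_)⟩
          rw [← (hRinc p l hlR).1 hi, ← (hRinc p m hm).1 hpm]
        rw [hset, Set.ncard_insert_of_notMem _ (hfin.sdiff.image _),
          (hinj _ hmem).ncard_image,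
          Set.ncard_sdiff_singleton_of_mem (show m ∈ {l | l ∈ L ∧ Inc p l} from ⟨hRL hm, hpm⟩),
          h.lines_through p hp, Nat.add_sub_cancel]
        rintro ⟨l, hl, hlz⟩
        exact Finset.disjoint_left.1 hd2 (Finset.mem_image_of_mem e
          (Finset.mk_mem_product ht (hmem l hl))) ((show e (t, l) = w p from hlz) ▸ Finset.mem_image_of_mem w hpQ)
      · have hmem : ∀ l ∈ {l | l ∈ L ∧ Inc p l}, l ∈ L \ R := fun l hl =>
          Finset.mem_sdiff.2 ⟨hl.1, fun hlR => hpQ (Finset.mem_filter.2 ⟨hp, l, hlR, hl.2⟩)⟩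
        rw [← h.lines_through p hp, ← (hinj _ hmem).ncard_image]
        congr 1
        ext y
        simp only [Finset.mem_union, Finset.mem_image, Finset.mem_product,
          Prod.exists (α := ℝ) (β := ℝ × ℝ), Set.mem_ofPred_eq, Set.mem_image]
        constructor
        · rintro ⟨⟨u, l, ⟨hu, hl⟩, rfl⟩ | ⟨q, hq, rfl⟩, hi⟩
          · have hl := (Finset.mem_sdiff.1 hl).1
            obtain ⟨rfl, hi'⟩ := (hinc t ht u hu p hp l hl).1 hi
            exact ⟨l, ⟨hl, hi'⟩, rfl⟩
          · exact absurd ((hfw t ht p hp q (Finset.mem_filter.1 hq).1).1 hi ▸ hq) hpQ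
        · rintro ⟨l, hl, rfl⟩
          exact ⟨Or.inl ⟨t, l, ⟨ht, hmem l hl⟩, rfl⟩, (hinc t ht t ht p hp l hl.1).2 ⟨rfl, hl.2⟩⟩
    · obtain ⟨l, hl, rfl⟩ := Finset.mem_image.1 hx
      rw [← h.points_on l (hRL hl), ← Set.ncard_image_of_injective {p | p ∈ P ∧ Inc p l} hw]
      congr 1
      ext y
      simp only [Finset.mem_union, Finset.mem_image, Finset.mem_product,
        Prod.exists (α := ℝ) (β := ℝ × ℝ), Set.mem_ofPred_eq, Set.mem_image]
      constructor
      · rintro ⟨⟨u, m, ⟨hu, hm⟩, rfl⟩ | ⟨q, hq, rfl⟩, hi⟩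
        · exact absurd hi (hze u hu l hl m (Finset.mem_sdiff.1 hm).1)
        · exact ⟨q, ⟨(Finset.mem_filter.1 hq).1, (hzw l hl q).1 hi⟩, rfl⟩
      · rintro ⟨p, ⟨hp, hi⟩, rfl⟩
        exact ⟨Or.inr ⟨p, Finset.mem_filter.2 ⟨hp, l, hl, hi⟩, rfl⟩, (hzw l hl p).2 hi⟩
  · intro x hx
    rcases Finset.mem_union.1 hx with hx | hx
    · obtain ⟨⟨t, l⟩, htx, rfl⟩ := Finset.mem_image.1 hx
      obtain ⟨ht, hl⟩ : t ∈ T ∧ l ∈ L \ R := Finset.mem_product.1 htx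
      have hl := (Finset.mem_sdiff.1 hl).1
      have hinj : Set.InjOn (fun p => f (t, p)) {p | p ∈ P ∧ Inc p l} :=
        fun p hp q hq hpq => (Prod.mk.inj (hf
          (Finset.mk_mem_product ht hp.1) (Finset.mk_mem_product ht hq.1) hpq)).2
      rw [← h.points_on l hl, ← hinj.ncard_image]
      congr 1
      ext y
      simp only [Finset.mem_union, Finset.mem_image, Finset.mem_product,
        Prod.exists (α := ℝ) (β := ℝ × ℝ), Set.mem_ofPred_eq, Set.mem_image]
      constructor
      · rintro ⟨⟨u, p, ⟨hu, hp⟩, rfl⟩ | ⟨m, hm, rfl⟩, hi⟩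
        · obtain ⟨rfl, hi'⟩ := (hinc u hu t ht p hp l hl).1 hi
          exact ⟨p, ⟨hp, hi'⟩, rfl⟩
        · exact absurd hi (hze t ht m hm l hl)
      · rintro ⟨p, ⟨hp, hi⟩, rfl⟩
        exact ⟨Or.inl ⟨t, p, ⟨ht, hp⟩, rfl⟩, (hinc t ht t ht p hp l hl).2 ⟨rfl, hi⟩⟩
    · obtain ⟨p, hpQ, rfl⟩ := Finset.mem_image.1 hx
      obtain ⟨hp, l, hl, hi⟩ := Finset.mem_filter.1 hpQ
      have hset : {q | q ∈ (T ×ˢ P).image f ∪ R.image z ∧ Inc q (w p)} =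
          insert (z l) ((fun t => f (t, p)) '' T) := by
        ext y
        simp only [Finset.mem_union, Finset.mem_image, Finset.mem_product,
          Prod.exists (α := ℝ) (β := ℝ × ℝ), Set.mem_ofPred_eq, Set.mem_insert_iff,
          Set.mem_image, Finset.mem_coe]
        constructor
        · rintro ⟨⟨u, q, ⟨hu, hq⟩, rfl⟩ | ⟨m, hm, rfl⟩, hi'⟩
          · obtain rfl := (hfw u hu q hq p hp).1 hi'
            exact Or.inr ⟨u, hu, rfl⟩
          · have := (hRinc p m hm).1 ((hzw m hm p).1 hi')
            exact Or.inl (by rw [hRinj m hm l hl (this.symm.trans ((hRinc p l hl).1 hi))])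
        · rintro (rfl | ⟨t, ht, rfl⟩)
          · exact ⟨Or.inr ⟨l, hl, rfl⟩, (hzw l hl p).2 hi⟩
          · exact ⟨Or.inl ⟨t, p, ⟨ht, hp⟩, rfl⟩, (hfw t ht p hp p hp).2 rfl⟩
      rw [hset, Set.ncard_insert_of_notMem _ (T.finite_toSet.image _), Set.InjOn.ncard_image,
        Set.ncard_coe_finset, hTc]
      · intro t ht u hu htu
        exact (Prod.mk.inj (hf (Finset.mk_mem_product ht hp) (Finset.mk_mem_product hu hp) htu)).1
      · rintro ⟨t, ht, htz⟩
        exact Finset.disjoint_left.1 hd1 (Finset.mem_image_of_mem f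
          (Finset.mk_mem_product ht hp)) ((show f (t, p) = z l from htz) ▸ Finset.mem_image_of_mem z hl)

/-! ### Between the Euclidean plane and coordinates -/

theorem IsStraightLine.exists_direction {l : AffineSubspace ℝ Plane} (hl : IsStraightLine l) :
    ∃ p v : Plane, v ≠ 0 ∧ ∀ q, q ∈ l ↔ ∃ c : ℝ, q = c • v + p := by
  obtain ⟨⟨p, hp⟩, hd⟩ := hl
  obtain ⟨v, hv, hspan⟩ := finrank_eq_one_iff'.1 hd
  refine ⟨p, v, by simpa using hv, fun q => ?_⟩
  rw [← AffineSubspace.vsub_right_mem_direction_iff_mem hp q]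
  constructor
  · intro hq
    obtain ⟨c, hc⟩ := hspan ⟨_, hq⟩
    refine ⟨c, ?_⟩
    have := congrArg Subtype.val hc
    simp only [Submodule.coe_smul, vsub_eq_sub] at this
    rw [this]; simp
  · rintro ⟨c, rfl⟩
    simpa using l.direction.smul_mem c v.2

theorem IsRealizable.exists_coordConfig {k n : ℕ} (h : IsRealizable k n) :
    0 < n ∧ ∃ P L, CoordConfig n k P L := by
  classical
  obtain ⟨P, L, h⟩ := h
  refine ⟨h.card_points ▸ h.nonempty.card_pos, ?_⟩
  choose! p v hv hmem using fun l hl => (h.isStraightLine l hl).exists_direction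
  -- A shear (x, y) ↦ (x + θ y, y) with generic θ leaves no line vertical.
  have e1 : ∀ᶠ θ : ℝ in Filter.cofinite, ∀ l ∈ L, v l 1 * θ ≠ -v l 0 := by
    refine (Filter.eventually_all_finset L).2 fun l hl => eventually_cofinite_linear ?_
    by_contra! hc
    refine hv l hl ?_
    ext i
    fin_cases i
    · simpa using hc.2
    · exact hc.1
  obtain ⟨θ, hθ⟩ := e1.exists
  let f : Plane → ℝ × ℝ := fun q => (q 0 + θ * q 1, q 1)
  let s : AffineSubspace ℝ Plane → ℝ := fun l => v l 1 / (v l 0 + θ * v l 1)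
  let g : AffineSubspace ℝ Plane → ℝ × ℝ := fun l => (s l, p l 1 - s l * (p l 0 + θ * p l 1))
  have hf : f.Injective := by
    intro q q' hq
    simp only [f, Prod.mk.injEq] at hq
    obtain ⟨h0, h1⟩ := hq
    ext i
    fin_cases i
    · simpa [h1] using h0
    · exact h1
  have hinc : ∀ q, ∀ l ∈ L, (Inc (f q) (g l) ↔ q ∈ l) := by
    intro q l hl
    have hd : v l 0 + θ * v l 1 ≠ 0 := fun h0 => hθ l hl (by linarith)
    rw [hmem l hl q]
    simp only [Inc, f, g, s]
    constructor
    · intro hi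
      have h1 : q 1 = (q 0 + θ * q 1 - (p l 0 + θ * p l 1)) / (v l 0 + θ * v l 1) * v l 1
          + p l 1 := by
        linear_combination hi
      refine ⟨(q 0 + θ * q 1 - (p l 0 + θ * p l 1)) / (v l 0 + θ * v l 1), ?_⟩
      generalize hc : (q 0 + θ * q 1 - (p l 0 + θ * p l 1)) / (v l 0 + θ * v l 1) = c at h1
      rw [div_eq_iff hd] at hc
      ext i
      fin_cases i
      · simp only [Fin.zero_eta, PiLp.add_apply, PiLp.smul_apply, smul_eq_mul]
        linear_combination hc - θ * h1
      · simpa using h1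
    · rintro ⟨c, rfl⟩
      simp only [PiLp.add_apply, PiLp.smul_apply, smul_eq_mul]
      linear_combination (-c) * div_mul_cancel₀ (v l 1) hd
  have hg : Set.InjOn g L := by
    intro l hl m hm hlm
    ext q
    rw [← hinc q l hl, ← hinc q m hm, hlm]
  refine ⟨P.image f, L.image g, ?_, ?_, ?_, ?_⟩
  · rw [Finset.card_image_of_injective _ hf, h.card_points]
  · rw [Finset.card_image_of_injOn hg, h.card_lines]
  · intro x hx
    obtain ⟨q, hq, rfl⟩ := Finset.mem_image.1 hx
    rw [← h.lines_through_point q hq, ← (hg.mono fun l hl => hl.1).ncard_image]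
    congr 1
    ext y
    simp only [Finset.mem_image, Set.mem_ofPred_eq, Set.mem_image]
    constructor
    · rintro ⟨⟨l, hl, rfl⟩, hi⟩
      exact ⟨l, ⟨hl, (hinc q l hl).1 hi⟩, rfl⟩
    · rintro ⟨l, ⟨hl, hi⟩, rfl⟩
      exact ⟨⟨l, hl, rfl⟩, (hinc q l hl).2 hi⟩
  · intro x hx
    obtain ⟨l, hl, rfl⟩ := Finset.mem_image.1 hx
    rw [← h.points_on_line l hl, ← Set.ncard_image_of_injective _ hf]
    congr 1
    ext y
    simp only [Finset.mem_image, Set.mem_ofPred_eq, Set.mem_image]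
    constructor
    · rintro ⟨⟨q, hq, rfl⟩, hi⟩
      exact ⟨q, ⟨hq, (hinc q l hl).1 hi⟩, rfl⟩
    · rintro ⟨q, ⟨hq, hi⟩, rfl⟩
      exact ⟨⟨q, hq, rfl⟩, (hinc q l hl).2 hi⟩

/-- The line `y = m x + b` of the plane. -/
noncomputable def lineOfCoords (l : ℝ × ℝ) : AffineSubspace ℝ Plane :=
  AffineSubspace.mk' !₂[0, l.2] (Submodule.span ℝ {!₂[1, l.1]})

theorem mem_lineOfCoords {q : Plane} {l : ℝ × ℝ} : q ∈ lineOfCoords l ↔ Inc (q 0, q 1) l := by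
  rw [lineOfCoords, AffineSubspace.mem_mk', Submodule.mem_span_singleton, Inc]
  constructor
  · rintro ⟨c, hc⟩
    have h0 := congrFun (congrArg WithLp.ofLp hc) 0
    have h1 := congrFun (congrArg WithLp.ofLp hc) 1
    simp at h0 h1
    simp only [← h0]
    linarith
  · intro hi
    refine ⟨q 0, ?_⟩
    ext i
    fin_cases i
    · simp
    · simp only at hi
      simp [hi]
      ring

theorem isStraightLine_lineOfCoords (l : ℝ × ℝ) : IsStraightLine (lineOfCoords l) := by
  refine ⟨⟨_, AffineSubspace.self_mem_mk' _ _⟩, ?_⟩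
  rw [lineOfCoords, AffineSubspace.direction_mk']
  refine finrank_span_singleton fun h => ?_
  simpa using congrFun (congrArg WithLp.ofLp h) 0

theorem lineOfCoords_injective : lineOfCoords.Injective := by
  intro l m hlm
  have h : ∀ x : ℝ, l.1 * x + l.2 = m.1 * x + m.2 := by
    intro x
    have : !₂[x, l.1 * x + l.2] ∈ lineOfCoords l := mem_lineOfCoords.2 (by simp [Inc])
    rw [hlm, mem_lineOfCoords] at this
    simpa [Inc] using this
  have h0 := h 0
  have h1 := h 1
  exact Prod.ext (by linarith) (by linarith)

theorem CoordConfig.isRealizable {n k : ℕ} {P L : Finset (ℝ × ℝ)} (h : CoordConfig n k P L)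
    (hn : 0 < n) : IsRealizable k n := by
  classical
  let f : ℝ × ℝ → Plane := fun p => !₂[p.1, p.2]
  have hf : f.Injective := by
    intro p q hpq
    have h0 := congrFun (congrArg WithLp.ofLp hpq) 0
    have h1 := congrFun (congrArg WithLp.ofLp hpq) 1
    exact Prod.ext h0 h1
  have hinc : ∀ p l, f p ∈ lineOfCoords l ↔ Inc p l := fun p l => mem_lineOfCoords
  refine ⟨P.image f, L.image lineOfCoords, ?_, ?_, ?_, ?_, ?_, ?_⟩
  · rw [Finset.image_nonempty, ← Finset.card_pos, h.card_points]
    exact hn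
  · intro x hx
    obtain ⟨l, -, rfl⟩ := Finset.mem_image.1 hx
    exact isStraightLine_lineOfCoords l
  · rw [Finset.card_image_of_injective _ hf, h.card_points]
  · rw [Finset.card_image_of_injective _ lineOfCoords_injective, h.card_lines]
  · intro x hx
    obtain ⟨p, hp, rfl⟩ := Finset.mem_image.1 hx
    rw [← h.lines_through p hp, ← Set.ncard_image_of_injective _ lineOfCoords_injective]
    congr 1
    ext y
    simp only [Finset.mem_image, Set.mem_ofPred_eq, Set.mem_image]
    constructor
    · rintro ⟨⟨l, hl, rfl⟩, hi⟩
      exact ⟨l, ⟨hl, (hinc p l).1 hi⟩, rfl⟩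
    · rintro ⟨l, ⟨hl, hi⟩, rfl⟩
      exact ⟨⟨l, hl, rfl⟩, (hinc p l).2 hi⟩
  · intro x hx
    obtain ⟨l, hl, rfl⟩ := Finset.mem_image.1 hx
    rw [← h.points_on l hl, ← Set.ncard_image_of_injective _ hf]
    congr 1
    ext y
    simp only [Finset.mem_image, Set.mem_ofPred_eq, Set.mem_image]
    constructor
    · rintro ⟨⟨q, hq, rfl⟩, hi⟩
      exact ⟨q, ⟨hq, (hinc q l).1 hi⟩, rfl⟩
    · rintro ⟨q, ⟨hq, hi⟩, rfl⟩
      exact ⟨⟨q, hq, rfl⟩, (hinc q l).2 hi⟩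

/-! ### Covering all large n -/

theorem IsRealizable.replicate_switch {k m r : ℕ} (h : IsRealizable k m) (hk : 0 < k)
    (hr : r ≤ m) : IsRealizable (k + 1) (k * ((k + 2) * m) + r) := by
  obtain ⟨hm, P, L, h⟩ := h.exists_coordConfig
  obtain ⟨P', L', h', H, hH, hHc, hH0⟩ := h.replicate
  obtain ⟨P'', L'', h''⟩ := h'.affineSwitch hH (hHc ▸ hr) hH0
  exact h''.isRealizable (by positivity)

/-- All sufficiently large `n` are `k`-realizable, with the explicit threshold
`configurationBound k a`. -/
theorem isRealizable_of_configurationBound_le {k a n : ℕ} (hk : 2 ≤ k)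
    (ha : ∀ m, a ≤ m → IsRealizable (k - 1) m) (hn : configurationBound k a ≤ n) :
    IsRealizable k n := by
  obtain ⟨j, rfl⟩ : ∃ j, k = j + 1 := ⟨k - 1, by omega⟩
  have hj : 0 < j := by omega
  have e1 : (j + 1) ^ 2 - 1 = j * (j + 2) := by
    rw [Nat.sub_eq_iff_eq_add (Nat.one_le_pow _ _ (by omega))]; ring
  have e2 : (j + 1) ^ 2 - 2 = j * (j + 2) - 1 := by omega
  rw [configurationBound, e1, e2] at hn
  simp only [Nat.add_sub_cancel] at ha
  have hpos : 0 < j * (j + 2) := by positivity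
  -- Division of n by j(j + 2) supplies m as quotient and r as remainder; r ≤ j(j + 2) - 1 ≤ m makes
  -- r admissible for the switch.
  have hq : max a (j * (j + 2) - 1) ≤ n / (j * (j + 2)) :=
    (Nat.le_div_iff_mul_le hpos).2 (by rwa [mul_comm])
  have hr := Nat.mod_lt n hpos
  have hn' := Nat.div_add_mod n (j * (j + 2))
  rw [← hn', mul_assoc]
  exact (ha _ (le_trans (le_max_left _ _) hq)).replicate_switch hj (by
    have := le_trans (le_max_right _ _) hq
    omega)

theorem mainTheorem2 (k : ℕ) (hk : 3 ≤ k) (N' : ℕ) (hN' : IsConfigurationNumber (k - 1) N') :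
    ∃ N : ℕ, IsConfigurationNumber k N ∧
      (∀ a : ℕ, N' ≤ a → N ≤ configurationBound k a) ∧
      (∀ a b : ℕ, N' ≤ a → a < b →
        configurationBound k a ≤ configurationBound k b ∧
        (configurationBound k a < configurationBound k b ↔ k ^ 2 - 2 < b)) := by
  have hmem : ∀ a : ℕ, N' ≤ a →
      configurationBound k a ∈ {M : ℕ | ∀ n : ℕ, M ≤ n → IsRealizable k n} := fun a ha n hn =>
    isRealizable_of_configurationBound_le (by omega) (fun m hm => hN'.1 m (ha.trans hm)) hn
  refine ⟨sInf {M : ℕ | ∀ n : ℕ, M ≤ n → IsRealizable k n},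
    ⟨Nat.sInf_mem ⟨_, hmem N' le_rfl⟩, fun M hM => Nat.sInf_le hM⟩,
    fun a ha => Nat.sInf_le (hmem a ha), fun a b _ hab => ?_⟩
  have hpos : 0 < k ^ 2 - 1 := by
    have : 3 ^ 2 ≤ k ^ 2 := Nat.pow_le_pow_left hk 2
    omega
  refine ⟨Nat.mul_le_mul_left _ (max_le_max_right _ hab.le), ?_⟩
  rw [configurationBound, configurationBound, Nat.mul_lt_mul_left hpos]
  -- Let c = k² - 2. If c < b, then b exceeds both a and c; otherwise both maxima equal c.
  omega
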